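/- Let $d\ge 1$ be an integer. All graphs are simple, and $d_G(x,y)$ denotes the distance in $G$ (with $d_G(x,y)=\infty$ if $x,y$ lie in different components). For a graph $G$, an integer $k$ and a finite set $N$, a labeling $\varphi:V(G)\to N$ is called *$k$-separating* if $\varphi(x)\neq\varphi(y)$ whenever $0<d_G(x,y)\le k$. Let $U_d^{r,k,N}$ be the set of isomorphism classes (root- and label-preserving) of rooted graphs of maximum degree at most $d$, all of whose vertices are at distance at most $r$ from the root, equipped with a $k$-separating labeling by $N$. A finite set $N$ is *$(k,d)$-large* if $|N|\ge |V(B)|$ for every rooted graph $B$ of maximum degree at most $d$ all of whose vertices are at distance at most $k$ from the root. A map $\Theta:U_d^{r,k,N}\to Q$ (an *oracle*, i.e. an $r$-round distributed algorithm) acts on $k$-separating labelings $\varphi:V(G)\to N$ of graphs $G$ of maximum degree at most $d$ by $O_\Theta(\varphi)(x)=\Theta(B_r(G,x,\varphi))$, where $B_r(G,x,\varphi)$ is the subgraph induced on the ball of radius $r$ around $x$, rooted at $x$ and labeled by $\varphi$. A map $\rho:V(G)\to Q$ is a *matching function* on $G$ if for every vertex $a$ there is at most one vertex $b$ with $0<d_G(a,b)\le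 5$ and $\rho(a)=\rho(b)$, and every such $b$ is adjacent to $a$; then the edges $ab$ of $G$ with $\rho(a)=\rho(b)$ form a matching $M_\rho$ of $G$. **Theorem.** For every $\varepsilon>0$ there exist integers $1\le n\le l$, a finite $(n,d)$-large set $N$, a finite $(5,d)$-large set $Q$ and an oracle $\Theta:U_d^{l,n,N}\to Q$ such that for every finite graph $G$ of maximum degree at most $d$ and every $n$-separating labeling $\varphi:V(G)\to N$, the labeling $\rho=O_\Theta(\varphi)$ is a matching function on $G$, and the matching $M_\rho$ satisfies $$|M_\rho|\ \ge\ \nu(G)-\varepsilon\,|V(G)|,$$ where $\nu(G)$ is the maximum number of edges of a matching of $G$. -/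

import Mathlib

namespace LocalMatching

/-- Every vertex of `G` has at most `d` neighbours. -/
def DegreeBounded {V : Type*} (G : SimpleGraph V) (d : ℕ) : Prop :=
  ∀ x, (G.neighborSet x).encard ≤ d

/-- `φ` is a `k`-separating labeling of `G`: distinct vertices at distance at most `k`
have different labels. (Vertices in different components have `edist` equal to `⊤`.) -/
def IsSeparating {V Q : Type*} (G : SimpleGraph V) (k : ℕ) (φ : V → Q) : Prop :=
  ∀ x y, 0 < G.edist x y → G.edist x y ≤ k → φ x ≠ φ y

/-- A rooted ball of radius `r` and vertex degree bound `d` (with an enumerated vertex set). -/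
structure RootedBall (d r : ℕ) where
  size : ℕ
  graph : SimpleGraph (Fin size)
  root : Fin size
  edist_le : ∀ y, graph.edist root y ≤ r
  degree_le : DegreeBounded graph d

/-- A rooted ball of radius `r` and vertex degree bound `d`, with a `k`-separating `Q`-labeling. -/
structure LabeledBall (d r k : ℕ) (Q : Type*) extends RootedBall d r where
  label : Fin size → Q
  separating : IsSeparating graph k label

/-- Rooted labeled isomorphism. -/
instance LabeledBall.instSetoid (d r k : ℕ) (Q : Type*) : Setoid (LabeledBall d r k Q) where
  r B C := ∃ e : B.graph ≃g C.graph, e B.root = C.root ∧ ∀ y, C.label (e y) = B.label y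
  iseqv :=
    { refl := fun _ => ⟨SimpleGraph.Iso.refl, rfl, fun _ => rfl⟩
      symm := by
        rintro B C ⟨e, h1, h2⟩
        refine ⟨e.symm, ?_, fun y => ?_⟩
        · rw [← h1]; exact e.symm_apply_apply _
        · rw [← h2]; exact congrArg C.label (e.apply_symm_apply y)
      trans := by
        rintro A B C ⟨e, h1, h2⟩ ⟨f, h3, h4⟩
        refine ⟨f.comp e, ?_, fun y => ?_⟩
        · rw [← h3, ← h1]; rfl
        · rw [← h2, ← h4]; rfl }

/-- The set of all `k`-separating `Q`-labeled rooted balls of radius `r` and vertex degree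
bound `d`, up to rooted labeled isomorphism. -/
def BallType (d r k : ℕ) (Q : Type*) : Type _ :=
  Quotient (LabeledBall.instSetoid d r k Q)

/-- `Q` is `(k, d)`-large: it has at least as many elements as any ball of radius `k` and
vertex degree bound `d` has vertices. -/
def IsLarge (k d : ℕ) (Q : Type*) : Prop :=
  ∀ B : RootedBall d k, B.size ≤ Nat.card Q

/-- The vertex set of the ball of radius `r` around `x`. -/
def ballSet {V : Type*} (G : SimpleGraph V) (r : ℕ) (x : V) : Set V :=
  {y | G.edist x y ≤ r}

/-- The ball of radius `r` around `x`, as an induced subgraph. -/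
abbrev ballGraph {V : Type*} (G : SimpleGraph V) (r : ℕ) (x : V) :
    SimpleGraph (ballSet G r x) :=
  G.induce (ballSet G r x)

theorem mem_ballSet_self {V : Type*} (G : SimpleGraph V) (r : ℕ) (x : V) :
    x ∈ ballSet G r x := by
  simp [ballSet]

theorem edist_map_le {V W : Type*} {G : SimpleGraph V} {H : SimpleGraph W}
    (f : G →g H) (x y : V) : H.edist (f x) (f y) ≤ G.edist x y := by
  by_cases h : G.Reachable x y
  · obtain ⟨p, hp⟩ := h.exists_walk_length_eq_edist
    rw [← hp, ← SimpleGraph.Walk.length_map f p]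
    exact SimpleGraph.edist_le _
  · rw [SimpleGraph.edist_eq_top_of_not_reachable h]
    exact le_top

theorem edist_ballGraph_le {V : Type*} (G : SimpleGraph V) (r : ℕ) (x : V)
    (y : ballSet G r x) :
    (ballGraph G r x).edist ⟨x, mem_ballSet_self G r x⟩ y ≤ r := by
  have hy : G.edist x y ≤ r := y.2
  have hr : G.Reachable x y := by
    by_contra h
    rw [SimpleGraph.edist_eq_top_of_not_reachable h] at hy
    simp at hy
  obtain ⟨p, hp⟩ := hr.exists_walk_length_eq_edist
  rw [← hp] at hy
  have hs : ∀ z ∈ p.support, z ∈ ballSet G r x := by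
    classical
    intro z hz
    refine le_trans (SimpleGraph.edist_le (p.takeUntil z hz)) (le_trans ?_ hy)
    exact_mod_cast p.length_takeUntil_le_length hz
  have hq := SimpleGraph.edist_le (p.induce (ballSet G r x) hs)
  refine le_trans hq (le_trans (le_of_eq ?_) hy)
  congr 1
  rw [← SimpleGraph.Walk.length_map (SimpleGraph.Embedding.induce (ballSet G r x)).toHom,
    SimpleGraph.Walk.map_induce]
  rfl

theorem DegreeBounded.of_embedding {V W : Type*} {G : SimpleGraph V} {H : SimpleGraph W} {d : ℕ}
    (h : DegreeBounded H d) (f : G ↪g H) : DegreeBounded G d := by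
  intro x
  refine le_trans ?_ (h (f x))
  rw [← f.injective.encard_image]
  refine Set.encard_le_encard ?_
  rintro _ ⟨z, hz, rfl⟩
  exact f.map_adj_iff.2 hz

theorem IsSeparating.of_embedding {V W Q : Type*} {G : SimpleGraph V} {H : SimpleGraph W} {k : ℕ}
    {φ : W → Q} (h : IsSeparating H k φ) (f : G ↪g H) : IsSeparating G k (φ ∘ f) := by
  intro x y h0 hk
  refine h _ _ ?_ (le_trans (edist_map_le f.toHom x y) hk)
  rw [pos_iff_ne_zero, Ne, SimpleGraph.edist_eq_zero_iff] at h0 ⊢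
  exact fun he => h0 (f.injective he)

/-- An arbitrary enumeration of the vertices of the ball of radius `r` around `x`. -/
noncomputable def ballEquiv {V : Type*} [Finite V] (G : SimpleGraph V) (r : ℕ) (x : V) :
    Fin (Nat.card (ballSet G r x)) ≃ ballSet G r x :=
  (Finite.equivFin _).symm

/-- The ball of radius `r` around `x` in `G`, labeled by the restriction of `φ`. -/
noncomputable def labeledBall {V Q : Type*} [Finite V] {G : SimpleGraph V} {d k : ℕ} {φ : V → Q}
    (hG : DegreeBounded G d) (hφ : IsSeparating G k φ) (r : ℕ) (x : V) :
    LabeledBall d r k Q where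
  size := Nat.card (ballSet G r x)
  graph := (ballGraph G r x).comap (ballEquiv G r x)
  root := (ballEquiv G r x).symm ⟨x, mem_ballSet_self G r x⟩
  label := fun i => φ (ballEquiv G r x i)
  edist_le := fun i => by
    have h1 := edist_map_le (SimpleGraph.Iso.comap (ballEquiv G r x) (ballGraph G r x)).symm.toHom
      ⟨x, mem_ballSet_self G r x⟩ (ballEquiv G r x i)
    have h2 := le_trans h1 (edist_ballGraph_le G r x _)
    have h3 : (SimpleGraph.Iso.comap (ballEquiv G r x) (ballGraph G r x)).symm.toHom
      (ballEquiv G r x i) = i := (ballEquiv G r x).symm_apply_apply i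
    rw [h3] at h2
    exact h2
  degree_le := hG.of_embedding
    ((SimpleGraph.Embedding.induce (ballSet G r x)).comp
      (SimpleGraph.Iso.comap (ballEquiv G r x) (ballGraph G r x)).toEmbedding)
  separating := hφ.of_embedding
    ((SimpleGraph.Embedding.induce (ballSet G r x)).comp
      (SimpleGraph.Iso.comap (ballEquiv G r x) (ballGraph G r x)).toEmbedding)

/-- The class of the labeled ball does not depend on the enumeration: two such classes agree
exactly when the two labeled balls are isomorphic. -/
theorem labeledBall_equiv_iff {V W Q : Type*} [Finite V] [Finite W] {G : SimpleGraph V}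
    {H : SimpleGraph W} {d k : ℕ} {φ : V → Q} {ψ : W → Q}
    (hG : DegreeBounded G d) (hφ : IsSeparating G k φ)
    (hH : DegreeBounded H d) (hψ : IsSeparating H k ψ) (r : ℕ) (x : V) (y : W) :
    (Quotient.mk _ (labeledBall hG hφ r x) : BallType d r k Q) =
        Quotient.mk _ (labeledBall hH hψ r y) ↔
      ∃ e : ballGraph G r x ≃g ballGraph H r y,
        e ⟨x, mem_ballSet_self G r x⟩ = ⟨y, mem_ballSet_self H r y⟩ ∧
          ∀ z, ψ (e z) = φ z := by
  let a := SimpleGraph.Iso.comap (ballEquiv G r x) (ballGraph G r x)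
  let b := SimpleGraph.Iso.comap (ballEquiv H r y) (ballGraph H r y)
  rw [Quotient.eq]
  constructor
  · rintro ⟨e, h1, h2⟩
    refine ⟨(b.comp e).comp a.symm, ?_, fun z => ?_⟩
    · exact (congrArg b h1).trans ((ballEquiv H r y).apply_symm_apply _)
    · exact (h2 (a.symm z)).trans (congrArg (fun w : ballSet G r x => φ w) (a.apply_symm_apply z))
  · rintro ⟨e, h1, h2⟩
    refine ⟨(b.symm.comp e).comp a, ?_, fun z => ?_⟩
    · refine congrArg b.symm (Eq.trans ?_ h1)
      exact congrArg e ((ballEquiv G r x).apply_symm_apply _)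
    · exact (congrArg (fun w : ballSet H r y => ψ w) (b.apply_symm_apply (e (a z)))).trans
        (h2 (a z))

/-- The operator `O_Θ` of an `r`-round algorithm with oracle `Θ`: the output at `x` is the value
of `Θ` at the isomorphism class of the labeled ball of radius `r` around `x`. -/
noncomputable def run {V N Q : Type*} [Finite V] {d r k : ℕ} (Θ : BallType d r k N → Q)
    {G : SimpleGraph V} (hG : DegreeBounded G d) {φ : V → N} (hφ : IsSeparating G k φ) : V → Q :=
  fun x => Θ (Quotient.mk _ (labeledBall hG hφ r x))

/-- Matching functions: every vertex `a` shares its label with at most one other vertex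
within distance `5`, and such a vertex is a neighbour of `a`. -/
structure IsMatchingFunction {V Q : Type*} (G : SimpleGraph V) (ρ : V → Q) : Prop where
  unique : ∀ a b c, 0 < G.edist a b → G.edist a b ≤ 5 → ρ a = ρ b →
    0 < G.edist a c → G.edist a c ≤ 5 → ρ a = ρ c → b = c
  adj : ∀ a b, 0 < G.edist a b → G.edist a b ≤ 5 → ρ a = ρ b → G.Adj a b

/-- The subgraph `M_ρ` formed by the edges of `G` whose endpoints have the same `ρ`-label. -/
def matchingOf {V Q : Type*} (G : SimpleGraph V) (ρ : V → Q) : G.Subgraph where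
  verts := {a | ∃ b, G.Adj a b ∧ ρ a = ρ b}
  Adj a b := G.Adj a b ∧ ρ a = ρ b
  adj_sub h := h.1
  edge_vert {_ b} h := ⟨b, h⟩
  symm := ⟨fun _ _ h => ⟨h.1.symm, h.2.symm⟩⟩

/-- The maximum number of edges of a matching of `G` (used for finite `G` only). -/
noncomputable def matchingNumber {V : Type*} (G : SimpleGraph V) : ℕ :=
  sSup {m | ∃ M : G.Subgraph, M.IsMatching ∧ M.edgeSet.ncard = m}

/-- For a finite graph the maximum is attained by a matching. -/
theorem matchingNumber_isGreatest {V : Type*} [Finite V] (G : SimpleGraph V) :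
    IsGreatest {m | ∃ M : G.Subgraph, M.IsMatching ∧ M.edgeSet.ncard = m}
      (matchingNumber G) := by
  have hb : BddAbove {m | ∃ M : G.Subgraph, M.IsMatching ∧ M.edgeSet.ncard = m} := by
    refine ⟨G.edgeSet.ncard, ?_⟩
    rintro _ ⟨M, -, rfl⟩
    exact Set.ncard_le_ncard M.edgeSet_subset (Set.toFinite _)
  have hn : {m | ∃ M : G.Subgraph, M.IsMatching ∧ M.edgeSet.ncard = m}.Nonempty :=
    ⟨_, ⊥, fun _ hv => hv.elim, rfl⟩
  exact ⟨Nat.sSup_mem hn hb, fun _ hm => le_csSup hb hm⟩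

end LocalMatching

/-! A matching is stored as a partner label on each vertex: its own label if unmatched, the label of
its partner otherwise. Starting from the empty matching, it is improved by local augmentations, in a
number of phases independent of the graph.

An augmentation is recorded by a `Pattern`: a set of at most `K` labels with old and new partner
labels and fewer unmatched labels afterwards. Since labels separate vertices at distance `3 * K`,
the active clusters of a pattern do not interfere and can be changed simultaneously. Each cluster
has at most `K` vertices and gains at least one unmatched vertex (`Pattern.card_active_add_le`).
Finitely many labels give finitely many patterns, and a phase runs through all of them.

To see that a phase makes progress, take any matching `g` and consider the components of its union
with the current matching `f`. Each contains at most two unmatched vertices, counted over `f` and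
`g` together, and at most `|V| / K` components have more than `K` vertices. A small component on
which `g` is better yields an improving pattern (`exists_pattern_of_component`), so the phase must
have touched that component. Hence a gap between `f` and `g` forces a gain (`unmatched_updates_le`).
While the gap exceeds `2 * ε * |V|`, each phase removes at least `|V| / K ^ 2` unmatched vertices,
so `K ^ 2` phases suffice (`unmatched_phases_le`).

Locality is tracked by an equivalence of bisimulation type, `LocallyEquiv`, under which the logical
operations used to define a phase are easily seen to be local. Isomorphic balls are equivalent in
this sense, so a local rule is given by an oracle (`Rule.IsLocal.exists_oracle`). -/

namespace LocalMatching

universe u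

/-! ### Message-passing equivalence and isomorphic balls -/

/-- Two rooted labelled graphs look the same to `r` rounds of message passing. -/
def LocallyEquiv {V W N : Type*} (G : SimpleGraph V) (φ : V → N) (H : SimpleGraph W) (ψ : W → N) :
    ℕ → V → W → Prop
  | 0, x, y => φ x = ψ y
  | r + 1, x, y => LocallyEquiv G φ H ψ r x y ∧
      (∀ x', G.Adj x x' → ∃ y', H.Adj y y' ∧ LocallyEquiv G φ H ψ r x' y') ∧
      (∀ y', H.Adj y y' → ∃ x', G.Adj x x' ∧ LocallyEquiv G φ H ψ r x' y')

namespace LocallyEquiv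

variable {V W N : Type*} {G : SimpleGraph V} {φ : V → N} {H : SimpleGraph W} {ψ : W → N}

theorem symm {r : ℕ} {x : V} {y : W} (h : LocallyEquiv G φ H ψ r x y) :
    LocallyEquiv H ψ G φ r y x := by
  induction r generalizing x y with
  | zero => exact Eq.symm h
  | succ r ih =>
    obtain ⟨h0, h1, h2⟩ := h
    refine ⟨ih h0, fun y' hy => ?_, fun x' hx => ?_⟩
    · obtain ⟨x', hx, h⟩ := h2 y' hy
      exact ⟨x', hx, ih h⟩
    · obtain ⟨y', hy, h⟩ := h1 x' hx
      exact ⟨y', hy, ih h⟩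

theorem mono {r s : ℕ} (hrs : r ≤ s) {x : V} {y : W} (h : LocallyEquiv G φ H ψ s x y) :
    LocallyEquiv G φ H ψ r x y := by
  induction s, hrs using Nat.le_induction with
  | base => exact h
  | succ s _ ih => exact ih h.1

/-- Each edge of the walk is copied to the other graph at the cost of one round. -/
theorem exists_of_walk {r : ℕ} {x x' : V} (p : G.Walk x x') :
    ∀ {t : ℕ} {y : W}, p.length ≤ t → LocallyEquiv G φ H ψ (r + t) x y →
      ∃ y', H.edist y y' ≤ t ∧ LocallyEquiv G φ H ψ r x' y' := by
  induction p with
  | nil => intro t y _ h; exact ⟨y, by simp, h.mono (Nat.le_add_right _ _)⟩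
  | cons hadj p ih =>
    intro t y ht h
    rw [SimpleGraph.Walk.length_cons] at ht
    obtain ⟨t, rfl⟩ : ∃ s, t = s + 1 := ⟨t - 1, by omega⟩
    obtain ⟨z, hyz, hz⟩ := h.2.1 _ hadj
    obtain ⟨y', hy', h'⟩ := ih (by omega) hz
    refine ⟨y', ?_, h'⟩
    calc H.edist y y' ≤ H.edist y z + H.edist z y' := SimpleGraph.edist_triangle
      _ ≤ 1 + t := add_le_add (SimpleGraph.edist_eq_one_iff_adj.2 hyz).le hy'
      _ = ((t + 1 : ℕ) : ℕ∞) := by push_cast; ring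

theorem exists_of_edist_le {r t : ℕ} {x x' : V} {y : W} (h : LocallyEquiv G φ H ψ (r + t) x y)
    (hx : G.edist x x' ≤ t) : ∃ y', H.edist y y' ≤ t ∧ LocallyEquiv G φ H ψ r x' y' := by
  obtain ⟨p, hp⟩ := SimpleGraph.exists_walk_of_edist_ne_top
    (ne_top_of_le_ne_top (ENat.natCast_ne_top t) hx)
  exact exists_of_walk p (by rw [← hp] at hx; exact_mod_cast hx) h

end LocallyEquiv

theorem edist_ballGraph_le_of_edist_le {V : Type*} (G : SimpleGraph V) {r k : ℕ} (hk : k ≤ r)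
    (x : V) (z : ballSet G r x) (hz : G.edist x z ≤ k) :
    (ballGraph G r x).edist ⟨x, mem_ballSet_self G r x⟩ z ≤ k := by
  have hsub : ballSet G k x ⊆ ballSet G r x := fun w (hw : G.edist x w ≤ k) =>
    le_trans hw (by exact_mod_cast hk)
  exact (edist_map_le (SimpleGraph.induceHomOfLE G hsub).toHom
    ⟨x, mem_ballSet_self G k x⟩ ⟨z, hz⟩).trans (edist_ballGraph_le G k x ⟨z, hz⟩)

theorem edist_ballIso_le {V W : Type*} {G : SimpleGraph V} {H : SimpleGraph W} {r k : ℕ}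
    (hk : k ≤ r) {x : V} {y : W} (e : ballGraph G r x ≃g ballGraph H r y)
    (he : e ⟨x, mem_ballSet_self G r x⟩ = ⟨y, mem_ballSet_self H r y⟩)
    (z : ballSet G r x) (hz : G.edist x z ≤ k) : H.edist y (e z) ≤ k := by
  have h1 := edist_map_le (SimpleGraph.Embedding.induce (G := H) (ballSet H r y)).toHom
    ⟨y, mem_ballSet_self H r y⟩ (e z)
  have h2 := edist_map_le e.toHom ⟨x, mem_ballSet_self G r x⟩ z
  have h3 : e.toHom ⟨x, mem_ballSet_self G r x⟩ = ⟨y, mem_ballSet_self H r y⟩ := he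
  rw [h3] at h2
  exact h1.trans (h2.trans (edist_ballGraph_le_of_edist_le G hk x z hz))

theorem edist_le_succ_of_adj {V : Type*} {G : SimpleGraph V} {x z z' : V} {k : ℕ}
    (hz : G.edist x z ≤ k) (h : G.Adj z z') : G.edist x z' ≤ (k + 1 : ℕ) := by
  push_cast
  exact SimpleGraph.edist_triangle.trans
    (add_le_add hz (SimpleGraph.edist_eq_one_iff_adj.2 h).le)

theorem locallyEquiv_of_ballIso {V W N : Type*} {G : SimpleGraph V} {H : SimpleGraph W}
    {φ : V → N} {ψ : W → N} {r : ℕ} {x : V} {y : W} (e : ballGraph G r x ≃g ballGraph H r y)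
    (he : e ⟨x, mem_ballSet_self G r x⟩ = ⟨y, mem_ballSet_self H r y⟩)
    (hlab : ∀ z, ψ (e z) = φ z) : LocallyEquiv G φ H ψ r x y := by
  have he' : e.symm ⟨y, mem_ballSet_self H r y⟩ = ⟨x, mem_ballSet_self G r x⟩ := by
    rw [← he, e.symm_apply_apply]
  -- A vertex at distance at most `k` from the centre can be followed for `r - k` rounds without
  -- leaving the ball.
  suffices h : ∀ j k : ℕ, k + j ≤ r → ∀ z : ballSet G r x, G.edist x z ≤ k →
      LocallyEquiv G φ H ψ j z (e z) by
    have := h r 0 (by omega) ⟨x, mem_ballSet_self G r x⟩ (by simp)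
    rwa [he] at this
  intro j
  induction j with
  | zero => intro k _ z _; exact (hlab z).symm
  | succ j ih =>
    intro k hk z hz
    refine ⟨ih k (by omega) z hz, fun z' hadj => ?_, fun w' hadj => ?_⟩
    · have hz' := edist_le_succ_of_adj hz hadj
      have hmem : z' ∈ ballSet G r x := hz'.trans (by exact_mod_cast (by omega : k + 1 ≤ r))
      refine ⟨e ⟨z', hmem⟩, ?_, ih (k + 1) (by omega) ⟨z', hmem⟩ hz'⟩
      exact e.map_adj_iff.2 (show (ballGraph G r x).Adj z ⟨z', hmem⟩ from hadj)
    · have hw' := edist_le_succ_of_adj (edist_ballIso_le (by omega) e he z hz) hadj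
      have hmem : w' ∈ ballSet H r y := hw'.trans (by exact_mod_cast (by omega : k + 1 ≤ r))
      have hback := edist_ballIso_le (by omega) e.symm he' ⟨w', hmem⟩ hw'
      have hloc := ih (k + 1) (by omega) (e.symm ⟨w', hmem⟩) hback
      rw [e.apply_symm_apply] at hloc
      refine ⟨e.symm ⟨w', hmem⟩, ?_, hloc⟩
      have := e.symm.map_adj_iff.2 (show (ballGraph H r y).Adj (e z) ⟨w', hmem⟩ from hadj)
      rw [e.symm_apply_apply] at this
      exact this

/-! ### Local rules and oracles -/

/-- A rule producing a vertex labelling of every finite `N`-labelled graph. -/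
abbrev Rule (N : Type*) (X : Type*) :=
  ∀ V : Type u, SimpleGraph V → (V → N) → V → X

/-- The value of the rule at a vertex depends only on boundedly many rounds of message passing. -/
def Rule.IsLocal {N X : Type*} (A : Rule.{u} N X) : Prop :=
  ∃ r : ℕ, ∀ (V W : Type u) (G : SimpleGraph V) (H : SimpleGraph W) (φ : V → N) (ψ : W → N)
    (x : V) (y : W), LocallyEquiv G φ H ψ r x y → A V G φ x = A W H ψ y

namespace Rule

variable {N X Y Z : Type*}

theorem isLocal_label : IsLocal.{u} (N := N) fun _ _ φ x => φ x :=
  ⟨0, fun _ _ _ _ _ _ _ _ h => h⟩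

theorem IsLocal.map {A : Rule.{u} N X} (hA : A.IsLocal) (F : X → Y) :
    IsLocal.{u} fun V G φ x => F (A V G φ x) := by
  obtain ⟨r, hr⟩ := hA
  exact ⟨r, fun V W G H φ ψ x y h => congrArg F (hr V W G H φ ψ x y h)⟩

theorem IsLocal.map₂ {A : Rule.{u} N X} {B : Rule.{u} N Y} (hA : A.IsLocal) (hB : B.IsLocal)
    (F : X → Y → Z) : IsLocal.{u} fun V G φ x => F (A V G φ x) (B V G φ x) := by
  obtain ⟨r, hr⟩ := hA
  obtain ⟨s, hs⟩ := hB
  refine ⟨max r s, fun V W G H φ ψ x y h => ?_⟩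
  exact congrArg₂ F (hr V W G H φ ψ x y (h.mono (le_max_left r s)))
    (hs V W G H φ ψ x y (h.mono (le_max_right r s)))

theorem isLocal_pi {ι : Type*} [Finite ι] {A : ι → Rule.{u} N X} (hA : ∀ i, (A i).IsLocal) :
    IsLocal.{u} fun V G φ x i => A i V G φ x := by
  choose r hr using hA
  obtain ⟨s, hs⟩ := Finite.exists_le r
  exact ⟨s, fun V W G H φ ψ x y h => funext fun i => hr i V W G H φ ψ x y (h.mono (hs i))⟩

theorem IsLocal.exists_near {A : Rule.{u} N Prop} (hA : A.IsLocal) (t : ℕ) :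
    IsLocal.{u} fun V G φ x => ∃ z : V, G.edist x z ≤ t ∧ A V G φ z := by
  obtain ⟨r, hr⟩ := hA
  refine ⟨r + t, fun V W G H φ ψ x y h => propext ⟨?_, ?_⟩⟩
  · rintro ⟨z, hz, hA⟩
    obtain ⟨w, hw, hzw⟩ := h.exists_of_edist_le hz
    exact ⟨w, hw, by rwa [← hr V W G H φ ψ z w hzw]⟩
  · rintro ⟨w, hw, hA⟩
    obtain ⟨z, hz, hzw⟩ := h.symm.exists_of_edist_le hw
    exact ⟨z, hz, by rwa [← hr W V H G ψ φ w z hzw]⟩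

theorem IsLocal.forall_near {A : Rule.{u} N Prop} (hA : A.IsLocal) (t : ℕ) :
    IsLocal.{u} fun V G φ x => ∀ z : V, G.edist x z ≤ t → A V G φ z := by
  have h := ((hA.map Not).exists_near t).map Not
  simpa only [not_exists, not_and, not_not] using h

theorem IsLocal.exists_adj {A : Rule.{u} N X} (hA : A.IsLocal) {B : Rule.{u} N Y} (hB : B.IsLocal)
    (F : X → Y → Prop) :
    IsLocal.{u} fun V G φ x => ∃ z : V, G.Adj x z ∧ F (A V G φ x) (B V G φ z) := by
  obtain ⟨r, hr⟩ := hA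
  obtain ⟨s, hs⟩ := hB
  refine ⟨max r s + 1, fun V W G H φ ψ x y h => propext ⟨?_, ?_⟩⟩
  · rintro ⟨z, hz, hF⟩
    obtain ⟨w, hw, hzw⟩ := h.2.1 z hz
    refine ⟨w, hw, ?_⟩
    rwa [← hr V W G H φ ψ x y (h.1.mono (le_max_left r s)),
      ← hs V W G H φ ψ z w (hzw.mono (le_max_right r s))]
  · rintro ⟨w, hw, hF⟩
    obtain ⟨z, hz, hzw⟩ := h.2.2 w hw
    refine ⟨z, hz, ?_⟩
    rwa [hr V W G H φ ψ x y (h.1.mono (le_max_left r s)),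
      hs V W G H φ ψ z w (hzw.mono (le_max_right r s))]

/-- A local rule is computed by an oracle, of every sufficiently large radius. -/
theorem IsLocal.exists_oracle [Nonempty X] {A : Rule.{u} N X} (hA : A.IsLocal) (d n : ℕ) :
    ∃ l, n ≤ l ∧ ∃ Θ : BallType d l n N → X, ∀ (V : Type u) [Finite V] (G : SimpleGraph V)
      (hG : DegreeBounded G d) (φ : V → N) (hφ : IsSeparating G n φ), run Θ hG hφ = A V G φ := by
  classical
  obtain ⟨r, hr⟩ := hA
  -- The oracle returns any value the rule takes at some realization of the ball type; locality
  -- makes all realizations agree.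
  let P (q : BallType d (max n r) n N) (a : X) : Prop :=
    ∃ (V : Type u) (_ : Finite V) (G : SimpleGraph V) (hG : DegreeBounded G d) (φ : V → N)
      (hφ : IsSeparating G n φ) (x : V),
      (Quotient.mk _ (labeledBall hG hφ (max n r) x) : BallType d (max n r) n N) = q ∧
        A V G φ x = a
  refine ⟨max n r, le_max_left n r, fun q => Classical.epsilon (P q), ?_⟩
  intro V _ G hG φ hφ
  funext x
  have hP : ∃ a, P (Quotient.mk _ (labeledBall hG hφ (max n r) x)) a :=
    ⟨_, V, ‹_›, G, hG, φ, hφ, x, rfl, rfl⟩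
  obtain ⟨W, _, H, hH, ψ, hψ, y, hy, ha⟩ := Classical.epsilon_spec hP
  obtain ⟨e, h1, h2⟩ := (labeledBall_equiv_iff hH hψ hG hφ (max n r) y x).1 hy
  have hloc := (locallyEquiv_of_ballIso e h1 h2).mono (le_max_right n r)
  exact ha.symm.trans (hr W V H G ψ φ y x hloc)

end Rule

/-! ### Matchings coded by partner labels -/

section Coding

variable {V N : Type*}

/-- `f` codes a matching of `G`: the vertex `x` is either unmatched and carries its own label, or
carries the label of a neighbour which carries the label of `x`. -/
def IsPartnerLabel (G : SimpleGraph V) (φ f : V → N) : Prop :=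
  ∀ x, f x = φ x ∨ ∃ z, G.Adj x z ∧ φ z = f x ∧ f z = φ x

open scoped Classical in
/-- The vertices left unmatched by `f`. -/
noncomputable def unmatched [Fintype V] (φ f : V → N) : Finset V := {x | f x = φ x}

theorem IsSeparating.eq_of_edist_le {G : SimpleGraph V} {φ : V → N} {n k : ℕ}
    (hφ : IsSeparating G n φ) (hk : k ≤ n) {x y : V} (hd : G.edist x y ≤ k) (h : φ x = φ y) :
    x = y := by
  by_contra hne
  exact hφ x y (SimpleGraph.edist_pos_of_ne hne) (hd.trans (by exact_mod_cast hk)) h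

theorem edist_le_add {G : SimpleGraph V} {x y z : V} {a b : ℕ} (h : G.edist x y ≤ a)
    (h' : G.edist y z ≤ b) : G.edist x z ≤ (a + b : ℕ) := by
  push_cast
  exact SimpleGraph.edist_triangle.trans (add_le_add h h')

theorem edist_le_of_adj {G : SimpleGraph V} {x y : V} (h : G.Adj x y) {k : ℕ} (hk : 1 ≤ k) :
    G.edist x y ≤ k :=
  (SimpleGraph.edist_eq_one_iff_adj.2 h).le.trans (by exact_mod_cast hk)

theorem edist_le_comm {G : SimpleGraph V} {x y : V} {k : ℕ∞} (h : G.edist x y ≤ k) :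
    G.edist y x ≤ k := by rwa [SimpleGraph.edist_comm]

end Coding

/-! ### Patterns and simultaneous augmentation -/

/-- A pattern prescribes how to change partner labels on a cluster with label set `support`. -/
structure Pattern (N : Type*) where
  support : Finset N
  old : N → N
  new : N → N

instance Pattern.instFinite (N : Type*) [Finite N] : Finite (Pattern N) :=
  Finite.of_injective (fun p : Pattern N => (p.support, p.old, p.new)) fun p q h => by
    cases p; cases q; simp_all

namespace Pattern

variable {V N : Type*}

open scoped Classical in
/-- The pattern has at most `K` labels and matches more of them after the change than before. -/
structure IsImproving (K : ℕ) (p : Pattern N) : Prop where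
  card_le : p.support.card ≤ K
  old_mem : ∀ c ∈ p.support, p.old c ∈ p.support
  new_mem : ∀ c ∈ p.support, p.new c ∈ p.support
  new_new : ∀ c ∈ p.support, p.new (p.new c) = c
  card_lt : (p.support.filter fun c => p.new c = c).card <
    (p.support.filter fun c => p.old c = c).card

/-- The surroundings of `y` agree with the pattern. -/
def Fits (K : ℕ) (p : Pattern N) (G : SimpleGraph V) (φ f : V → N) (y : V) : Prop :=
  (∀ c ∈ p.support, ∃ z, G.edist y z ≤ K ∧ φ z = c) ∧ f y = p.old (φ y) ∧
    (p.new (φ y) = φ y ∨ ∃ z, G.Adj y z ∧ p.new (φ y) = φ z)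

/-- The vertex `x` lies in a cluster that agrees with the pattern. -/
def Active (K : ℕ) (p : Pattern N) (G : SimpleGraph V) (φ f : V → N) (x : V) : Prop :=
  φ x ∈ p.support ∧ ∀ y, G.edist x y ≤ K → φ y ∈ p.support → p.Fits K G φ f y

open scoped Classical in
/-- Change the partner labels according to an improving pattern on all clusters agreeing
with it. -/
noncomputable def update (K : ℕ) (p : Pattern N) (G : SimpleGraph V) (φ f : V → N) : V → N :=
  fun x => if p.IsImproving K ∧ p.Active K G φ f x then p.new (φ x) else f x

theorem update_of_active {K : ℕ} {p : Pattern N} {G : SimpleGraph V} {φ f : V → N} {x : V}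
    (hp : p.IsImproving K) (hx : p.Active K G φ f x) : p.update K G φ f x = p.new (φ x) :=
  if_pos ⟨hp, hx⟩

theorem update_of_not_active {K : ℕ} {p : Pattern N} {G : SimpleGraph V} {φ f : V → N} {x : V}
    (hx : ¬ (p.IsImproving K ∧ p.Active K G φ f x)) : p.update K G φ f x = f x :=
  if_neg hx

theorem Active.fits {K : ℕ} {p : Pattern N} {G : SimpleGraph V} {φ f : V → N} {x : V}
    (hx : p.Active K G φ f x) : p.Fits K G φ f x :=
  hx.2 x (by simp) hx.1

/-- The cluster of `x` already contains a vertex for every label of the support. A vertex within `K`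
of `y` carrying such a label is within `3 * K` of its namesake in that cluster, hence equal to it,
so `y` sees nothing that `x` does not. -/
theorem Active.of_edist_le {K n : ℕ} {p : Pattern N} {G : SimpleGraph V} {φ f : V → N}
    (hφ : IsSeparating G n φ) (hn : 3 * K ≤ n) {x y : V} (hx : p.Active K G φ f x)
    (hxy : G.edist x y ≤ K) (hy : φ y ∈ p.support) : p.Active K G φ f y := by
  refine ⟨hy, fun z hyz hz => ?_⟩
  obtain ⟨z', hz', heq⟩ := hx.fits.1 _ hz
  have hd := edist_le_add (edist_le_add (edist_le_comm hz') hxy) hyz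
  obtain rfl : z' = z := hφ.eq_of_edist_le (by omega) hd heq
  exact hx.2 z' hz' hz

theorem isPartnerLabel_update {K n : ℕ} (hK : 1 ≤ K) (p : Pattern N) {G : SimpleGraph V}
    {φ f : V → N} (hφ : IsSeparating G n φ) (hn : 3 * K ≤ n) (hf : IsPartnerLabel G φ f) :
    IsPartnerLabel G φ (p.update K G φ f) := by
  by_cases hp : p.IsImproving K
  swap
  · rwa [show p.update K G φ f = f from funext fun x => update_of_not_active fun h => hp h.1]
  intro x
  by_cases hx : p.Active K G φ f x
  · rw [update_of_active hp hx]
    rcases hx.fits.2.2 with h | ⟨z, hxz, hz⟩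
    · exact Or.inl h
    · have hz' : φ z ∈ p.support := hz ▸ hp.new_mem _ hx.1
      have := hx.of_edist_le hφ hn (edist_le_of_adj hxz hK) hz'
      refine Or.inr ⟨z, hxz, hz.symm, ?_⟩
      rw [update_of_active hp this, ← hz, hp.new_new _ hx.1]
  · rw [update_of_not_active fun h => hx h.2]
    rcases hf x with h | ⟨z, hxz, hz, hz'⟩
    · exact Or.inl h
    · refine Or.inr ⟨z, hxz, hz, ?_⟩
      rw [update_of_not_active, hz']
      -- An active partner would make `x` active: `old` preserves the support, so the label of `x`
      -- belongs to it.
      rintro ⟨-, hact⟩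
      have hxs : φ x ∈ p.support := by
        rw [← hz', hact.fits.2.1]
        exact hp.old_mem _ hact.1
      exact hx (hact.of_edist_le hφ hn (edist_le_of_adj hxz.symm hK) hxs)

/-! ### Counting active vertices -/

section Counting

variable [Fintype V]

-- Send each active vertex labelled `c` to the vertex labelled `c'` in its cluster. Two vertices
-- with the same image are within `2 * K` of each other and share a label, so they coincide.
open scoped Classical in
theorem card_active_fiber_le {K n : ℕ} {p : Pattern N} {G : SimpleGraph V} {φ f : V → N}
    (hφ : IsSeparating G n φ) (hn : 3 * K ≤ n) (c : N) {c' : N} (hc' : c' ∈ p.support) :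
    (Finset.univ.filter fun x => p.Active K G φ f x ∧ φ x = c).card ≤
      (Finset.univ.filter fun x => p.Active K G φ f x ∧ φ x = c').card := by
  have hex : ∀ x, ∃ z, p.Active K G φ f x → G.edist x z ≤ K ∧ φ z = c' := fun x => by
    by_cases hx : p.Active K G φ f x
    · obtain ⟨z, hz⟩ := hx.fits.1 c' hc'
      exact ⟨z, fun _ => hz⟩
    · exact ⟨x, fun h => (hx h).elim⟩
  choose g hg using hex
  refine Finset.card_le_card_of_injOn g (fun x hx => ?_) fun x hx y hy hxy => ?_
  · simp only [Finset.coe_filter, Finset.mem_univ, true_and, Set.mem_ofPred_eq] at hx ⊢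
    obtain ⟨h1, h2⟩ := hg x hx.1
    exact ⟨hx.1.of_edist_le hφ hn h1 (h2 ▸ hc'), h2⟩
  · simp only [Finset.coe_filter, Finset.mem_univ, true_and, Set.mem_ofPred_eq] at hx hy
    have h1 := (hg x hx.1).1
    rw [hxy] at h1
    exact hφ.eq_of_edist_le (by omega) (edist_le_add h1 (edist_le_comm (hg y hy.1).1))
      (hx.2.trans hy.2.symm)

-- The number `q` plays the role of the number of clusters: every label of the support occurs
-- equally often among the active vertices.
open scoped Classical in
theorem exists_card_active_eq_mul {K n : ℕ} (p : Pattern N) {G : SimpleGraph V} {φ : V → N}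
    (f : V → N) (hφ : IsSeparating G n φ) (hn : 3 * K ≤ n) :
    ∃ q : ℕ, ∀ P : N → Prop,
      (Finset.univ.filter fun x => p.Active K G φ f x ∧ P (φ x)).card =
        (p.support.filter P).card * q := by
  obtain ⟨q, hq⟩ : ∃ q, ∀ c ∈ p.support,
      (Finset.univ.filter fun x => p.Active K G φ f x ∧ φ x = c).card = q := by
    rcases p.support.eq_empty_or_nonempty with h | ⟨c, hc⟩
    · exact ⟨0, by simp [h]⟩
    · exact ⟨_, fun c' hc' => le_antisymm (card_active_fiber_le hφ hn c' hc)
        (card_active_fiber_le hφ hn c hc')⟩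
  refine ⟨q, fun P => ?_⟩
  rw [Finset.card_eq_sum_card_fiberwise (f := φ) (t := p.support.filter P),
    Finset.sum_const_nat (m := q)]
  · intro c hc
    rw [Finset.mem_filter] at hc
    rw [← hq c hc.1, Finset.filter_filter]
    congr 1
    ext x
    simp only [Finset.mem_filter, Finset.mem_univ, true_and]
    constructor
    · rintro ⟨⟨h1, -⟩, h2⟩; exact ⟨h1, h2⟩
    · rintro ⟨h1, rfl⟩; exact ⟨⟨h1, hc.2⟩, rfl⟩
  · intro x hx
    simp only [Finset.coe_filter, Finset.mem_univ, true_and, Set.mem_ofPred_eq] at hx ⊢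
    exact ⟨hx.1.1, hx.2⟩

-- With `q` clusters, at most `K * q` vertices are active, while the number of unmatched vertices
-- drops by at least `q`.
open scoped Classical in
theorem card_active_add_le {K n : ℕ} (p : Pattern N) {G : SimpleGraph V} {φ : V → N}
    (f : V → N) (hφ : IsSeparating G n φ) (hn : 3 * K ≤ n) :
    (Finset.univ.filter fun x => p.IsImproving K ∧ p.Active K G φ f x).card +
      K * (unmatched φ (p.update K G φ f)).card ≤ K * (unmatched φ f).card := by
  by_cases hp : p.IsImproving K
  swap
  · rw [show p.update K G φ f = f from funext fun x => update_of_not_active fun h => hp h.1]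
    simp [hp]
  obtain ⟨q, hq⟩ := exists_card_active_eq_mul p f hφ hn
  have key : ∀ g : V → N, (unmatched φ g).card =
      (Finset.univ.filter fun x => p.Active K G φ f x ∧ g x = φ x).card +
        (Finset.univ.filter fun x => ¬ p.Active K G φ f x ∧ g x = φ x).card := fun g => by
    rw [unmatched, ← Finset.card_filter_add_card_filter_not (fun x => p.Active K G φ f x),
      Finset.filter_filter, Finset.filter_filter]
    simp only [and_comm]
  have hA : (Finset.univ.filter fun x => p.IsImproving K ∧ p.Active K G φ f x).card =
      p.support.card * q := by
    simpa [hp] using hq fun _ => True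
  have h1 : (Finset.univ.filter fun x => p.Active K G φ f x ∧ f x = φ x).card =
      (p.support.filter fun c => p.old c = c).card * q := by
    rw [← hq]
    congr 1
    ext x
    simp only [Finset.mem_filter, Finset.mem_univ, true_and]
    refine and_congr_right fun h => ?_
    rw [h.fits.2.1]
  have h2 : (Finset.univ.filter fun x =>
      p.Active K G φ f x ∧ p.update K G φ f x = φ x).card =
      (p.support.filter fun c => p.new c = c).card * q := by
    rw [← hq]
    congr 1
    ext x
    simp only [Finset.mem_filter, Finset.mem_univ, true_and]
    refine and_congr_right fun h => ?_
    rw [update_of_active hp h]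
  have h3 : (Finset.univ.filter fun x =>
      ¬ p.Active K G φ f x ∧ p.update K G φ f x = φ x) =
      Finset.univ.filter fun x => ¬ p.Active K G φ f x ∧ f x = φ x := by
    ext x
    simp only [Finset.mem_filter, Finset.mem_univ, true_and]
    refine and_congr_right fun h => ?_
    rw [update_of_not_active fun h' => h h'.2]
  rw [key f, key, hA, h1, h2, h3]
  have hlt := hp.card_lt
  have hc := hp.card_le
  have e1 := Nat.mul_le_mul_right q hc
  have e2 := Nat.mul_le_mul_left K (Nat.mul_le_mul_right q (Nat.succ_le_of_lt hlt))
  rw [Nat.succ_mul, Nat.mul_add] at e2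
  rw [Nat.mul_add, Nat.mul_add]
  omega

end Counting

/-! ### Locality of updates and runs through a list of patterns -/

theorem isLocal_update [Finite N] (K : ℕ) (p : Pattern N) {F : Rule.{u} N N} (hF : F.IsLocal) :
    Rule.IsLocal.{u} fun V G φ => p.update K G φ (F V G φ) := by
  have hlab := Rule.isLocal_label.{u} (N := N)
  have h1 : Rule.IsLocal.{u} fun V G φ (x : V) =>
      ∀ c : N, c ∈ p.support → ∃ z, G.edist x z ≤ K ∧ φ z = c :=
    (Rule.isLocal_pi fun c => ((hlab.map (· = c)).exists_near K).map (c ∈ p.support → ·)).map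
      fun Q : N → Prop => ∀ c, Q c
  have h2 : Rule.IsLocal.{u} fun V G φ (x : V) => F V G φ x = p.old (φ x) :=
    hF.map₂ hlab fun a c => a = p.old c
  have h3 : Rule.IsLocal.{u} fun V G φ (x : V) =>
      p.new (φ x) = φ x ∨ ∃ z, G.Adj x z ∧ p.new (φ x) = φ z :=
    (hlab.map fun c => p.new c = c).map₂ (hlab.exists_adj hlab fun a c => p.new a = c) Or
  have h4 : Rule.IsLocal.{u} fun V G φ (x : V) => p.Fits K G φ (F V G φ) x :=
    h1.map₂ (h2.map₂ h3 And) And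
  have h5 : Rule.IsLocal.{u} fun V G φ (x : V) => p.Active K G φ (F V G φ) x :=
    (hlab.map (· ∈ p.support)).map₂
      (((hlab.map (· ∈ p.support)).map₂ h4 fun P Q => P → Q).forall_near K) And
  classical
  have h6 := ((h5.map (p.IsImproving K ∧ ·)).map₂ hlab fun P c => (P, p.new c)).map₂ hF
    fun a b => if a.1 then a.2 else b
  convert h6 using 5
  simp only [update]

/-- Apply a list of patterns one after the other. -/
noncomputable def updates (K : ℕ) (L : List (Pattern N)) (G : SimpleGraph V) (φ f : V → N) :
    V → N :=
  L.foldl (fun f p => p.update K G φ f) f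

theorem updates_cons (K : ℕ) (p : Pattern N) (L : List (Pattern N)) (G : SimpleGraph V)
    (φ f : V → N) : updates K (p :: L) G φ f = updates K L G φ (p.update K G φ f) := rfl

theorem isPartnerLabel_updates {K n : ℕ} (hK : 1 ≤ K) (L : List (Pattern N)) {G : SimpleGraph V}
    {φ : V → N} (hφ : IsSeparating G n φ) (hn : 3 * K ≤ n) {f : V → N}
    (hf : IsPartnerLabel G φ f) : IsPartnerLabel G φ (updates K L G φ f) := by
  induction L generalizing f with
  | nil => exact hf
  | cons p L ih => exact ih (isPartnerLabel_update hK p hφ hn hf)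

theorem isLocal_updates [Finite N] (K : ℕ) (L : List (Pattern N)) {F : Rule.{u} N N}
    (hF : F.IsLocal) : Rule.IsLocal.{u} fun V G φ => updates K L G φ (F V G φ) := by
  induction L generalizing F with
  | nil => exact hF
  | cons p L ih => exact ih (isLocal_update K p hF)

/-- The vertices active at some stage are few compared with the gain. -/
theorem exists_touched [Fintype V] {K n : ℕ} (L : List (Pattern N)) {G : SimpleGraph V}
    {φ : V → N} (hφ : IsSeparating G n φ) (hn : 3 * K ≤ n) (f : V → N) :
    ∃ A : Finset V, A.card + K * (unmatched φ (updates K L G φ f)).card ≤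
        K * (unmatched φ f).card ∧
      ∀ p ∈ L, p.IsImproving K → ∃ g : V → N, (∀ x ∉ A, g x = f x) ∧
        ∀ x, p.Active K G φ g x → x ∈ A := by
  classical
  induction L generalizing f with
  | nil => exact ⟨∅, by simp [updates], by simp⟩
  | cons p L ih =>
    obtain ⟨A, hA, hL⟩ := ih (p.update K G φ f)
    have hB := card_active_add_le p f hφ hn
    set B := Finset.univ.filter fun x => p.IsImproving K ∧ p.Active K G φ f x with hBdef
    refine ⟨B ∪ A, ?_, ?_⟩
    · rw [updates_cons]
      have := Finset.card_union_le B A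
      omega
    · intro p' hp' himp
      rcases List.mem_cons.1 hp' with rfl | hp'
      -- The witness is the labelling at the moment the pattern is processed; for the head of the
      -- list this is `f` itself.
      · refine ⟨f, fun _ _ => rfl, fun x hx => Finset.mem_union_left _ ?_⟩
        simp [hBdef, himp, hx]
      · obtain ⟨g, hg, hact⟩ := hL p' hp' himp
        refine ⟨g, fun x hx => ?_, fun x hx => Finset.mem_union_right _ (hact x hx)⟩
        rw [Finset.mem_union, not_or] at hx
        rw [hg x hx.2]
        exact update_of_not_active fun h => hx.1 (by simp [hBdef, h])

end Pattern

/-! ### Degree sums and connected components -/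

theorem two_mul_card_le_sum_degree_add_two {W : Type*} [Fintype W] {H : SimpleGraph W}
    [DecidableRel H.Adj] (h : H.Connected) : 2 * Fintype.card W ≤ ∑ x, H.degree x + 2 := by
  have := h.card_vert_le_card_edgeSet_add_one
  rw [Nat.card_eq_fintype_card, Nat.card_eq_fintype_card, ← SimpleGraph.edgeFinset_card] at this
  rw [SimpleGraph.sum_degrees_eq_twice_card_edges]
  omega

section Components

variable {V : Type*} [Fintype V]

open scoped Classical in
/-- The vertices of a connected component. -/
noncomputable def componentFinset {H : SimpleGraph V} (C : H.ConnectedComponent) : Finset V :=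
  {x | H.connectedComponentMk x = C}

theorem mem_componentFinset {H : SimpleGraph V} {C : H.ConnectedComponent} {x : V} :
    x ∈ componentFinset C ↔ H.connectedComponentMk x = C := by
  simp [componentFinset]

theorem mem_componentFinset_of_adj {H : SimpleGraph V} {C : H.ConnectedComponent} {x y : V}
    (hx : x ∈ componentFinset C) (h : H.Adj x y) : y ∈ componentFinset C := by
  rw [mem_componentFinset] at hx ⊢
  rw [← hx]
  exact (SimpleGraph.ConnectedComponent.sound h.reachable).symm

theorem edist_le_card_componentFinset {H : SimpleGraph V} {C : H.ConnectedComponent} {x y : V}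
    (hx : x ∈ componentFinset C) (hy : y ∈ componentFinset C) :
    H.edist x y ≤ (componentFinset C).card := by
  classical
  rw [mem_componentFinset] at hx hy
  have hr : H.Reachable x y := SimpleGraph.ConnectedComponent.exact (hx.trans hy.symm)
  obtain ⟨p, hp⟩ := hr.exists_isPath
  refine (SimpleGraph.edist_le p).trans ?_
  have hsub : p.support.toFinset ⊆ componentFinset C := fun z hz => by
    rw [List.mem_toFinset] at hz
    rw [mem_componentFinset, ← hx]
    exact SimpleGraph.ConnectedComponent.sound (p.takeUntil z hz).reachable.symm
  have := Finset.card_le_card hsub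
  rw [List.toFinset_card_of_nodup hp.support_nodup, SimpleGraph.Walk.length_support] at this
  exact_mod_cast (by omega : p.length ≤ _)

open scoped Classical in
theorem two_mul_card_component_le {H : SimpleGraph V} (C : H.ConnectedComponent) :
    2 * (componentFinset C).card ≤ ∑ x ∈ componentFinset C, H.degree x + 2 := by
  have h := two_mul_card_le_sum_degree_add_two (C.connected_toSimpleGraph)
  have hmem : ∀ x, x ∈ componentFinset C ↔ x ∈ C := fun x => mem_componentFinset
  have hcard : Fintype.card C = (componentFinset C).card := Fintype.card_of_subtype _ hmem
  rw [hcard] at h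
  refine h.trans (Nat.add_le_add_right ?_ 2)
  rw [Finset.sum_subtype (componentFinset C) hmem fun x => H.degree x]
  refine Finset.sum_le_sum fun x _ => ?_
  rw [← SimpleGraph.card_neighborFinset_eq_degree, ← SimpleGraph.card_neighborFinset_eq_degree]
  refine Finset.card_le_card_of_injOn Subtype.val (fun y hy => ?_)
    Subtype.val_injective.injOn
  rw [Finset.mem_coe, SimpleGraph.mem_neighborFinset] at hy ⊢
  exact hy

end Components

/-! ### Comparison of two matchings -/

section Comparison

variable {V N : Type*}

/-- The union of the matchings coded by `f` and `g`. -/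
def unionGraph (G : SimpleGraph V) (φ f g : V → N) : SimpleGraph V where
  Adj x z := G.Adj x z ∧ ((f x = φ z ∧ f z = φ x) ∨ (g x = φ z ∧ g z = φ x))
  symm := ⟨fun _ _ h => ⟨h.1.symm, h.2.imp And.symm And.symm⟩⟩
  loopless := ⟨fun _ h => h.1.ne rfl⟩

theorem unionGraph_le (G : SimpleGraph V) (φ f g : V → N) : unionGraph G φ f g ≤ G :=
  fun _ _ h => h.1

variable [Fintype V] {G : SimpleGraph V} {φ f g : V → N} {n K : ℕ}

theorem mem_unmatched {x : V} : x ∈ unmatched φ f ↔ f x = φ x := by simp [unmatched]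

open scoped Classical in
theorem card_partners_add_le (hφ : IsSeparating G n φ) (hn : 2 ≤ n) (x : V) :
    (Finset.univ.filter fun z => G.Adj x z ∧ f x = φ z ∧ f z = φ x).card +
      (if f x = φ x then 1 else 0) ≤ 1 := by
  split_ifs with h
  · rw [Finset.filter_false_of_mem]
    · simp
    · rintro z - ⟨hxz, h1, -⟩
      exact hxz.ne (hφ.eq_of_edist_le (by omega) (edist_le_of_adj hxz le_rfl) (h.symm.trans h1))
  · refine Finset.card_le_one.2 fun z hz w hw => ?_
    simp only [Finset.mem_filter, Finset.mem_univ, true_and] at hz hw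
    exact hφ.eq_of_edist_le hn
      (edist_le_add (edist_le_of_adj hz.1.symm le_rfl) (edist_le_of_adj hw.1 le_rfl))
      (hz.2.1.symm.trans hw.2.1)

-- Each of the two matchings contributes at most one to the left side: either a union edge at `x` or
-- the fact that `x` is unmatched.
open scoped Classical in
theorem degree_unionGraph_add_le (hφ : IsSeparating G n φ) (hn : 2 ≤ n) (x : V) :
    (unionGraph G φ f g).degree x + (if f x = φ x then 1 else 0) +
      (if g x = φ x then 1 else 0) ≤ 2 := by
  have hf := card_partners_add_le (f := f) hφ hn x
  have hg := card_partners_add_le (f := g) hφ hn x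
  have h : (unionGraph G φ f g).degree x ≤
      (Finset.univ.filter fun z => G.Adj x z ∧ f x = φ z ∧ f z = φ x).card +
        (Finset.univ.filter fun z => G.Adj x z ∧ g x = φ z ∧ g z = φ x).card := by
    rw [← SimpleGraph.card_neighborFinset_eq_degree]
    refine (Finset.card_le_card fun z hz => ?_).trans (Finset.card_union_le _ _)
    rw [SimpleGraph.mem_neighborFinset] at hz
    simp only [Finset.mem_union, Finset.mem_filter, Finset.mem_univ, true_and]
    exact hz.2.imp (fun h => ⟨hz.1, h⟩) fun h => ⟨hz.1, h⟩
  omega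

-- Connectedness makes the degree sum at least `2 * |C| - 2`, and degrees plus unmatched indicators
-- sum to at most `2 * |C|`. This avoids classifying components as paths and cycles.
open scoped Classical in
theorem card_unmatched_component_le (hφ : IsSeparating G n φ) (hn : 2 ≤ n)
    (C : (unionGraph G φ f g).ConnectedComponent) :
    ((componentFinset C).filter fun x => f x = φ x).card +
      ((componentFinset C).filter fun x => g x = φ x).card ≤ 2 := by
  have h1 := two_mul_card_component_le C
  have h2 : ∑ x ∈ componentFinset C, ((unionGraph G φ f g).degree x +
      (if f x = φ x then 1 else 0) + (if g x = φ x then 1 else 0)) ≤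
        ∑ _x ∈ componentFinset C, 2 :=
    Finset.sum_le_sum fun x _ => degree_unionGraph_add_le hφ hn x
  rw [Finset.sum_add_distrib, Finset.sum_add_distrib, Finset.sum_const, smul_eq_mul,
    ← Finset.card_filter, ← Finset.card_filter] at h2
  omega

theorem partner_mem_component (hf : IsPartnerLabel G φ f) {x : V}
    {C : (unionGraph G φ f g).ConnectedComponent} (hx : x ∈ componentFinset C) :
    f x = φ x ∨ ∃ z ∈ componentFinset C, G.Adj x z ∧ φ z = f x ∧ f z = φ x :=
  (hf x).imp id fun ⟨z, hxz, h1, h2⟩ =>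
    ⟨z, mem_componentFinset_of_adj hx ⟨hxz, Or.inl ⟨h1.symm, h2⟩⟩, hxz, h1, h2⟩

theorem partner_mem_component' (hg : IsPartnerLabel G φ g) {x : V}
    {C : (unionGraph G φ f g).ConnectedComponent} (hx : x ∈ componentFinset C) :
    g x = φ x ∨ ∃ z ∈ componentFinset C, G.Adj x z ∧ φ z = g x ∧ g z = φ x :=
  (hg x).imp id fun ⟨z, hxz, h1, h2⟩ =>
    ⟨z, mem_componentFinset_of_adj hx ⟨hxz, Or.inr ⟨h1.symm, h2⟩⟩, hxz, h1, h2⟩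

open scoped Classical in
/-- A small component on which `g` matches more vertices than `f` gives rise to an improving
pattern, which is active on the component for every labelling that agrees with `f` there. -/
theorem exists_pattern_of_component (hφ : IsSeparating G n φ) (hn : 3 * K ≤ n)
    (hf : IsPartnerLabel G φ f) (hg : IsPartnerLabel G φ g)
    (C : (unionGraph G φ f g).ConnectedComponent) (hC : (componentFinset C).card ≤ K)
    (hlt : ((componentFinset C).filter fun x => g x = φ x).card <
      ((componentFinset C).filter fun x => f x = φ x).card) :
    ∃ p : Pattern N, p.IsImproving K ∧ ∀ h : V → N, (∀ x ∈ componentFinset C, h x = f x) →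
      ∀ x ∈ componentFinset C, p.Active K G φ h x := by
  have hdist : ∀ x ∈ componentFinset C, ∀ y ∈ componentFinset C, G.edist x y ≤ K :=
    fun x hx y hy => (SimpleGraph.edist_anti (unionGraph_le G φ f g)).trans
      ((edist_le_card_componentFinset hx hy).trans (by exact_mod_cast hC))
  -- The component has diameter at most `K`, so labels name its vertices and `f`, `g` can be
  -- transported to functions on labels.
  have hinj : Set.InjOn φ (componentFinset C) := fun x hx y hy hxy =>
    hφ.eq_of_edist_le (by omega) (hdist x hx y hy) hxy
  have : Nonempty V := ⟨C.out⟩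
  have hinv : ∀ x ∈ componentFinset C, Function.invFunOn φ (componentFinset C) (φ x) = x :=
    fun x hx => hinj.leftInvOn_invFunOn hx
  have hcard : ∀ k : V → N, (((componentFinset C).image φ).filter fun c =>
      k (Function.invFunOn φ (componentFinset C) c) = c).card =
        ((componentFinset C).filter fun x => k x = φ x).card := fun k => by
    rw [Finset.filter_image, Finset.card_image_of_injOn
      (hinj.mono (Finset.coe_subset.2 (Finset.filter_subset _ _)))]
    congr 1
    exact Finset.filter_congr fun x hx => by rw [hinv x hx]
  refine ⟨⟨(componentFinset C).image φ,
    fun c => f (Function.invFunOn φ (componentFinset C) c),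
    fun c => g (Function.invFunOn φ (componentFinset C) c)⟩, ⟨?_, ?_, ?_, ?_, ?_⟩, ?_⟩
  · exact Finset.card_image_le.trans hC
  · simp only [Finset.forall_mem_image]
    intro x hx
    rw [hinv x hx]
    rcases partner_mem_component hf hx with h | ⟨z, hz, -, h, -⟩
    · rw [h]; exact Finset.mem_image_of_mem φ hx
    · rw [← h]; exact Finset.mem_image_of_mem φ hz
  · simp only [Finset.forall_mem_image]
    intro x hx
    rw [hinv x hx]
    rcases partner_mem_component' hg hx with h | ⟨z, hz, -, h, -⟩
    · rw [h]; exact Finset.mem_image_of_mem φ hx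
    · rw [← h]; exact Finset.mem_image_of_mem φ hz
  · simp only [Finset.forall_mem_image]
    intro x hx
    rw [hinv x hx]
    rcases partner_mem_component' hg hx with h | ⟨z, hz, -, h, h'⟩
    · rw [h, hinv x hx, h]
    · rw [← h, hinv z hz, h']
  · simp only [hcard]
    exact hlt
  · intro h hh x hx
    refine ⟨Finset.mem_image_of_mem φ hx, fun y hxy hy => ?_⟩
    obtain ⟨y', hy', heq⟩ := Finset.mem_image.1 hy
    -- Both vertices are within `K` of `x`, so a nearby vertex with a label of the support lies in
    -- the component.
    obtain rfl : y' = y := hφ.eq_of_edist_le (by omega)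
      (edist_le_add (edist_le_comm (hdist x hx y' hy')) hxy) heq
    refine ⟨?_, ?_, ?_⟩
    · simp only [Finset.forall_mem_image]
      exact fun z hz => ⟨z, hdist y' hy' z hz, rfl⟩
    · simp only [hinv y' hy', hh y' hy']
    · simp only [hinv y' hy']
      exact (hg y').imp id fun ⟨z, h1, h2, _⟩ => ⟨z, h1, h2.symm⟩

open scoped Classical in
theorem card_unmatched_eq_sum (H : SimpleGraph V) (φ f : V → N) :
    (unmatched φ f).card =
      ∑ C : H.ConnectedComponent, ((componentFinset C).filter fun x => f x = φ x).card := by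
  rw [Finset.card_eq_sum_card_fiberwise (f := H.connectedComponentMk) (t := Finset.univ)
    (fun _ _ => by simp)]
  refine Finset.sum_congr rfl fun C _ => ?_
  congr 1
  ext x
  simp [mem_unmatched, mem_componentFinset, and_comm]

open scoped Classical in
theorem mul_card_large_components_le (H : SimpleGraph V) (K : ℕ) :
    K * (Finset.univ.filter fun C : H.ConnectedComponent =>
      ¬ (componentFinset C).card ≤ K).card ≤ Fintype.card V := by
  have h : Fintype.card V = ∑ C : H.ConnectedComponent, (componentFinset C).card := by
    rw [← Finset.card_univ, Finset.card_eq_sum_card_fiberwise (f := H.connectedComponentMk)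
      (t := Finset.univ) (fun _ _ => by simp)]
    rfl
  rw [h, mul_comm, ← smul_eq_mul]
  refine (Finset.card_nsmul_le_sum _ (fun C => (componentFinset C).card) K fun C hC => ?_).trans
    (Finset.sum_le_sum_of_subset (Finset.subset_univ _))
  exact (not_le.1 (Finset.mem_filter.1 hC).2).le

/-- One phase closes part of the gap between `f` and any other matching `g`. -/
theorem unmatched_updates_le (hφ : IsSeparating G n φ) (hn : 3 * K ≤ n) (hn' : 2 ≤ n)
    (hf : IsPartnerLabel G φ f) (hg : IsPartnerLabel G φ g) {L : List (Pattern N)}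
    (hL : ∀ p, p ∈ L) :
    K * (unmatched φ f).card + 2 * K ^ 2 * (unmatched φ (Pattern.updates K L G φ f)).card ≤
      K * (unmatched φ g).card + 2 * K ^ 2 * (unmatched φ f).card + 2 * Fintype.card V := by
  classical
  obtain ⟨A, hA, hact⟩ := Pattern.exists_touched L hφ hn f
  set H := unionGraph G φ f g with hH
  set a : H.ConnectedComponent → ℕ := fun C =>
    ((componentFinset C).filter fun x => f x = φ x).card with ha
  set b : H.ConnectedComponent → ℕ := fun C =>
    ((componentFinset C).filter fun x => g x = φ x).card with hb
  set large : Finset H.ConnectedComponent := Finset.univ.filter fun C =>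
    ¬ (componentFinset C).card ≤ K with hlarge
  have htouch : ∀ C : H.ConnectedComponent, b C < a C → C ∉ large →
      C ∈ A.image H.connectedComponentMk := by
    intro C hlt hC
    have hC' : (componentFinset C).card ≤ K := by simpa [hlarge] using hC
    obtain ⟨p, hp, hpact⟩ := exists_pattern_of_component hφ hn hf hg C hC' hlt
    obtain ⟨h, hh, hhact⟩ := hact p (hL p) hp
    -- If no touched vertex lies in `C`, the labelling `h` at the pattern's turn still agrees with
    -- `f` on `C`. The pattern is then active there, which puts vertices of `C` into `A`.
    by_contra hno
    have hdisj : ∀ x ∈ componentFinset C, x ∉ A := fun x hx hxA =>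
      hno (Finset.mem_image.2 ⟨x, hxA, mem_componentFinset.1 hx⟩)
    have hout : C.out ∈ componentFinset C := mem_componentFinset.2 C.out_eq
    exact hdisj _ hout (hhact _ (hpact h (fun x hx => hh x (hdisj x hx)) _ hout))
  -- A component with excess is touched or large, and its excess is at most 2.
  have hterm : ∀ C : H.ConnectedComponent, a C ≤ b C +
      ((if C ∈ A.image H.connectedComponentMk then 2 else 0) + if C ∈ large then 2 else 0) := by
    intro C
    have h2 : a C + b C ≤ 2 := card_unmatched_component_le hφ hn' C
    by_cases hlt : b C < a C
    · by_cases hC : C ∈ large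
      · simp only [hC, if_true]; omega
      · simp only [htouch C hlt hC, if_true]; omega
    · omega
  have hsum := Finset.sum_le_sum fun C (_ : C ∈ Finset.univ) => hterm C
  rw [Finset.sum_add_distrib, Finset.sum_add_distrib, ← card_unmatched_eq_sum,
    ← card_unmatched_eq_sum, Finset.sum_ite_mem, Finset.sum_ite_mem, Finset.univ_inter,
    Finset.univ_inter, Finset.sum_const, Finset.sum_const, smul_eq_mul, smul_eq_mul] at hsum
  have himg : (A.image H.connectedComponentMk).card ≤ A.card := Finset.card_image_le
  have hlargeK : K * large.card ≤ Fintype.card V := mul_card_large_components_le H K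
  have h1 : K * (unmatched φ f).card ≤
      K * ((unmatched φ g).card + (A.card * 2 + large.card * 2)) :=
    Nat.mul_le_mul_left K (by omega)
  have h2 := Nat.mul_le_mul_left (2 * K) hA
  nlinarith

theorem unmatched_updates_mono (hφ : IsSeparating G n φ) (hK : 0 < K) (hn : 3 * K ≤ n)
    (L : List (Pattern N)) :
    (unmatched φ (Pattern.updates K L G φ f)).card ≤ (unmatched φ f).card := by
  obtain ⟨A, hA, -⟩ := Pattern.exists_touched L hφ hn f
  exact Nat.le_of_mul_le_mul_left (by omega) hK

end Comparison

/-! ### Passage between partner labels, matchings and matching functions -/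

section Matchings

variable {V N : Type*} {G : SimpleGraph V}

theorem ncard_verts_of_isMatching [Finite V] {M : G.Subgraph} (hM : M.IsMatching) :
    M.verts.ncard = 2 * M.edgeSet.ncard := by
  classical
  have := Fintype.ofFinite V
  have h := M.spanningCoe.sum_degrees_eq_twice_card_edges
  have hdeg : ∀ v, M.spanningCoe.degree v = if v ∈ M.verts then 1 else 0 := fun v => by
    rw [SimpleGraph.Subgraph.degree_spanningCoe]
    split_ifs with hv
    · exact SimpleGraph.Subgraph.isMatching_iff_forall_degree.1 hM v hv
    · exact SimpleGraph.Subgraph.degree_of_notMem_verts hv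
  simp only [hdeg] at h
  rw [← Finset.card_filter, SimpleGraph.edgeFinset, ← Set.ncard_eq_toFinset_card',
    SimpleGraph.Subgraph.edgeSet_spanningCoe] at h
  rw [← h, Set.ncard_eq_toFinset_card']
  congr 1
  ext v
  simp

theorem card_eq_card_unmatched_add [Fintype V] {φ f : V → N} {M : G.Subgraph}
    (hM : M.IsMatching) (h : ∀ x, x ∈ M.verts ↔ f x ≠ φ x) :
    Fintype.card V = (unmatched φ f).card + 2 * M.edgeSet.ncard := by
  classical
  rw [← ncard_verts_of_isMatching hM, unmatched,
    ← Finset.card_univ, ← Finset.card_filter_add_card_filter_not (fun x => f x = φ x),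
    Set.ncard_eq_toFinset_card']
  congr 2
  ext x
  simp [h]

theorem exists_isPartnerLabel_of_isMatching [Fintype V] {φ : V → N} {n : ℕ}
    (hφ : IsSeparating G n φ) (hn : 1 ≤ n) {M : G.Subgraph} (hM : M.IsMatching) :
    ∃ g : V → N, IsPartnerLabel G φ g ∧
      Fintype.card V = (unmatched φ g).card + 2 * M.edgeSet.ncard := by
  classical
  have hex : ∀ x, ∃ c, (x ∈ M.verts → ∃ z, M.Adj x z ∧ φ z = c) ∧ (x ∉ M.verts → c = φ x) := by
    intro x
    by_cases hx : x ∈ M.verts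
    · obtain ⟨z, hz, -⟩ := hM hx
      exact ⟨φ z, fun _ => ⟨z, hz, rfl⟩, fun h => (h hx).elim⟩
    · exact ⟨φ x, fun h => (hx h).elim, fun _ => rfl⟩
  choose g hg1 hg2 using hex
  refine ⟨g, fun x => ?_, card_eq_card_unmatched_add hM fun x => ⟨fun hx h => ?_, fun h => ?_⟩⟩
  · by_cases hx : x ∈ M.verts
    · obtain ⟨z, hz, hzc⟩ := hg1 x hx
      obtain ⟨w, hw, hwc⟩ := hg1 z hz.snd_mem
      obtain rfl := hM.eq_of_adj_left hz.symm hw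
      exact Or.inr ⟨z, hz.adj_sub, hzc, hwc.symm⟩
    · exact Or.inl (hg2 x hx)
  · obtain ⟨z, hz, hzc⟩ := hg1 x hx
    exact hz.adj_sub.ne
      (hφ.eq_of_edist_le hn (edist_le_of_adj hz.adj_sub le_rfl) (h.symm.trans hzc.symm))
  · by_contra hx
    exact h (hg2 x hx)

/-- The label of `x` given by the unordered pair of labels of its matching edge. -/
def edgeLabel (φ f : V → N) (x : V) : Sym2 N := s(φ x, f x)

variable {φ f : V → N} {n : ℕ}

/-- Equal unordered pairs with `φ a ≠ φ b` must match crosswise, so `b` has a partner labelled like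
`a`. That partner is within `5 + 1` of `a`, which is why separation at distance 6 identifies it with
`a`. -/
theorem eq_partner_of_edgeLabel_eq (hφ : IsSeparating G n φ) (hn : 6 ≤ n)
    (hf : IsPartnerLabel G φ f) {a b : V} (h0 : 0 < G.edist a b) (h5 : G.edist a b ≤ 5)
    (h : edgeLabel φ f a = edgeLabel φ f b) : G.Adj a b ∧ φ b = f a ∧ f b = φ a := by
  have hne : φ a ≠ φ b := hφ a b h0 (h5.trans (by exact_mod_cast (by omega : 5 ≤ n)))
  rcases Sym2.eq_iff.1 h with ⟨h1, -⟩ | ⟨h1, h2⟩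
  · exact (hne h1).elim
  · rcases hf b with hb | ⟨z, hbz, hz, hz'⟩
    · exact (hne (h1.trans hb)).elim
    · obtain rfl : a = z := hφ.eq_of_edist_le hn
        (edist_le_add (b := 1) (by exact_mod_cast h5) (edist_le_of_adj hbz le_rfl))
        (h1.trans hz.symm)
      exact ⟨hbz.symm, h2.symm, h1.symm⟩

theorem isMatchingFunction_edgeLabel (hφ : IsSeparating G n φ) (hn : 6 ≤ n)
    (hf : IsPartnerLabel G φ f) : IsMatchingFunction G (edgeLabel φ f) where
  unique a b c h0 h5 h h0' h5' h' := by
    have hb := eq_partner_of_edgeLabel_eq hφ hn hf h0 h5 h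
    have hc := eq_partner_of_edgeLabel_eq hφ hn hf h0' h5' h'
    exact hφ.eq_of_edist_le (by omega)
      (edist_le_add (edist_le_of_adj hb.1.symm le_rfl) (edist_le_of_adj hc.1 le_rfl))
      (hb.2.1.trans hc.2.1.symm)
  adj a b h0 h5 h := (eq_partner_of_edgeLabel_eq hφ hn hf h0 h5 h).1

theorem matchingOf_edgeLabel_adj_iff (hφ : IsSeparating G n φ) (hn : 6 ≤ n)
    (hf : IsPartnerLabel G φ f) {a b : V} :
    (matchingOf G (edgeLabel φ f)).Adj a b ↔ G.Adj a b ∧ φ b = f a ∧ f b = φ a := by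
  constructor
  · rintro ⟨hab, h⟩
    have h1 := SimpleGraph.edist_eq_one_iff_adj.2 hab
    exact eq_partner_of_edgeLabel_eq hφ hn hf (by simp [h1]) (by rw [h1]; norm_num) h
  · rintro ⟨hab, h1, h2⟩
    refine ⟨hab, ?_⟩
    rw [edgeLabel, edgeLabel, h1, h2, Sym2.eq_swap]

theorem isMatching_matchingOf_edgeLabel (hφ : IsSeparating G n φ) (hn : 6 ≤ n)
    (hf : IsPartnerLabel G φ f) : (matchingOf G (edgeLabel φ f)).IsMatching := by
  rintro a ⟨b, hab⟩
  refine ⟨b, hab, fun c hac => ?_⟩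
  have hb := (matchingOf_edgeLabel_adj_iff hφ hn hf).1 hab
  have hc := (matchingOf_edgeLabel_adj_iff hφ hn hf).1 hac
  exact hφ.eq_of_edist_le (by omega)
    (edist_le_add (edist_le_of_adj hc.1.symm le_rfl) (edist_le_of_adj hb.1 le_rfl))
    (hc.2.1.trans hb.2.1.symm)

theorem mem_verts_matchingOf_edgeLabel_iff (hφ : IsSeparating G n φ) (hn : 6 ≤ n)
    (hf : IsPartnerLabel G φ f) (x : V) :
    x ∈ (matchingOf G (edgeLabel φ f)).verts ↔ f x ≠ φ x := by
  constructor
  · rintro ⟨b, hb⟩ h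
    have hb := (matchingOf_edgeLabel_adj_iff hφ hn hf).1 hb
    exact hb.1.ne (hφ.eq_of_edist_le (by omega) (edist_le_of_adj hb.1 le_rfl)
      (h.symm.trans hb.2.1.symm))
  · intro h
    rcases hf x with h' | ⟨z, hz⟩
    · exact (h h').elim
    · exact ⟨z, (matchingOf_edgeLabel_adj_iff hφ hn hf).2 hz⟩

end Matchings

/-! ### Ball sizes and large label sets -/

section Sizes

theorem ncard_ballSet_le {V : Type*} [Finite V] {G : SimpleGraph V} {d : ℕ}
    (hG : DegreeBounded G d) (x : V) (r : ℕ) : (ballSet G r x).ncard ≤ (d + 1) ^ r := by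
  classical
  have := Fintype.ofFinite V
  induction r with
  | zero =>
    have : ballSet G 0 x = {x} := by
      ext y
      simp [ballSet, SimpleGraph.edist_eq_zero_iff, eq_comm (a := y)]
    simp [this]
  | succ r ih =>
    have hsub : ballSet G (r + 1) x ⊆
        ((ballSet G r x).toFinset.biUnion fun y => insert y (G.neighborFinset y) : Finset V) := by
      intro y hy
      obtain ⟨p, hp⟩ := SimpleGraph.exists_walk_of_edist_ne_top
        (ne_top_of_le_ne_top (ENat.natCast_ne_top (r + 1)) hy)
      have hlen : p.length ≤ r + 1 := by
        have : G.edist x y ≤ (r + 1 : ℕ) := hy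
        rw [← hp] at this
        exact_mod_cast this
      rw [Finset.mem_coe, Finset.mem_biUnion]
      by_cases hr : p.length ≤ r
      · refine ⟨y, ?_, Finset.mem_insert_self _ _⟩
        rw [Set.mem_toFinset]
        exact (SimpleGraph.edist_le p).trans (by exact_mod_cast hr)
      · have hnil : ¬ p.Nil := fun h => by
          rw [← SimpleGraph.Walk.length_eq_zero_iff] at h
          omega
        -- A walk of length exactly `r + 1` reaches `y` from a neighbour in the smaller ball.
        refine ⟨p.penultimate, ?_, ?_⟩
        · rw [Set.mem_toFinset]
          refine (SimpleGraph.edist_le p.dropLast).trans ?_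
          have : p.dropLast.length ≤ r := by
            rw [SimpleGraph.Walk.length_dropLast]
            omega
          exact_mod_cast this
        · rw [Finset.mem_insert, SimpleGraph.mem_neighborFinset]
          exact Or.inr (p.adj_penultimate hnil)
    refine (Set.ncard_le_ncard hsub (Set.toFinite _)).trans ?_
    rw [Set.ncard_coe_finset]
    refine (Finset.card_biUnion_le_card_mul _ _ (d + 1) fun y _ => ?_).trans ?_
    · refine (Finset.card_insert_le _ _).trans (Nat.add_le_add_right ?_ 1)
      have := hG y
      rw [Set.encard_eq_coe_toFinset_card] at this
      exact_mod_cast this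
    · rw [← Set.ncard_eq_toFinset_card', pow_succ]
      exact Nat.mul_le_mul_right _ ih

theorem isLarge_of_le {k d : ℕ} {Q : Type*} (h : (d + 1) ^ k ≤ Nat.card Q) : IsLarge k d Q := by
  intro B
  have huniv : ballSet B.graph k B.root = Set.univ :=
    Set.eq_univ_of_forall fun y => B.edist_le y
  have := ncard_ballSet_le B.degree_le B.root k
  rw [huniv, Set.ncard_univ, Nat.card_fin] at this
  exact this.trans h

end Sizes

/-! ### Iterating phases until the gap closes -/

section Phases

variable {V N : Type*}

/-- The partner labels after `t` phases of changes along the patterns in `L`. -/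
noncomputable def phases (K : ℕ) (L : List (Pattern N)) (t : ℕ) (G : SimpleGraph V) (φ : V → N) :
    V → N :=
  (Pattern.updates K L G φ)^[t] φ

theorem phases_succ (K : ℕ) (L : List (Pattern N)) (t : ℕ) (G : SimpleGraph V) (φ : V → N) :
    phases K L (t + 1) G φ = Pattern.updates K L G φ (phases K L t G φ) :=
  Function.iterate_succ_apply' _ _ _

theorem isLocal_phases [Finite N] (K : ℕ) (L : List (Pattern N)) (t : ℕ) :
    Rule.IsLocal.{u} fun V G φ => phases (V := V) K L t G φ := by
  induction t with
  | zero => exact Rule.isLocal_label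
  | succ t ih =>
    simp only [phases_succ]
    exact Pattern.isLocal_updates K L ih

theorem isPartnerLabel_phases {K n : ℕ} (hK : 1 ≤ K) (L : List (Pattern N)) (t : ℕ)
    {G : SimpleGraph V} {φ : V → N} (hφ : IsSeparating G n φ) (hn : 3 * K ≤ n) :
    IsPartnerLabel G φ (phases K L t G φ) := by
  induction t with
  | zero => exact fun x => Or.inl rfl
  | succ t ih =>
    rw [phases_succ]
    exact Pattern.isPartnerLabel_updates hK L hφ hn ih

theorem unmatched_phases_le [Fintype V] {K n : ℕ} (hK : 1 ≤ K) (hn : 3 * K ≤ n)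
    {L : List (Pattern N)} (hL : ∀ p, p ∈ L) {G : SimpleGraph V} {φ : V → N}
    (hφ : IsSeparating G n φ) {g : V → N} (hg : IsPartnerLabel G φ g) {ε : ℝ}
    (hε : 2 ≤ K * ε) :
    ((unmatched φ (phases K L (K ^ 2) G φ)).card : ℝ) ≤
      (unmatched φ g).card + 2 * ε * Fintype.card V := by
  have hK0 : (0 : ℝ) < K := by exact_mod_cast hK
  have hεp : 0 ≤ ε := by
    by_contra h
    nlinarith
  -- Either the gap has closed, which persists by monotonicity, or every phase so far has removed at
  -- least `|V| / K ^ 2` unmatched vertices.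
  have key : ∀ t : ℕ, ((unmatched φ (phases K L t G φ)).card : ℝ) ≤
        (unmatched φ g).card + 2 * ε * Fintype.card V ∨
      (K : ℝ) ^ 2 * (unmatched φ (phases K L t G φ)).card ≤
        ((K : ℝ) ^ 2 - t) * Fintype.card V := by
    intro t
    induction t with
    | zero =>
      right
      rw [Nat.cast_zero, sub_zero]
      have : (unmatched φ (phases K L 0 G φ)).card ≤ Fintype.card V := Finset.card_le_univ _
      gcongr
    | succ t ih =>
      rw [phases_succ]
      have hmono := unmatched_updates_mono (f := phases K L t G φ) hφ hK hn L
      have hstep := unmatched_updates_le hφ hn (by omega)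
        (isPartnerLabel_phases hK L t hφ hn) hg hL
      have hmono' : ((unmatched φ (Pattern.updates K L G φ (phases K L t G φ))).card : ℝ) ≤
        (unmatched φ (phases K L t G φ)).card := by exact_mod_cast hmono
      by_cases hgap : ((unmatched φ (phases K L t G φ)).card : ℝ) ≤
        (unmatched φ g).card + 2 * ε * Fintype.card V
      · exact Or.inl (hmono'.trans hgap)
      · right
        have ih := ih.resolve_left hgap
        rw [not_le] at hgap
        have hstep' : (K : ℝ) * (unmatched φ (phases K L t G φ)).card +
            2 * (K : ℝ) ^ 2 *
              (unmatched φ (Pattern.updates K L G φ (phases K L t G φ))).card ≤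
            K * (unmatched φ g).card +
              2 * (K : ℝ) ^ 2 * (unmatched φ (phases K L t G φ)).card +
                2 * Fintype.card V := by exact_mod_cast hstep
        -- An open gap contributes `2 * K * ε * |V| ≥ 4 * |V|` in `hstep'`. After the error `2 *
        -- |V|`, a gain of `2 * |V|` remains for `2 * K ^ 2` times the drop.
        have h1 := mul_le_mul_of_nonneg_left hgap.le hK0.le
        have h2 := mul_le_mul_of_nonneg_right hε (Nat.cast_nonneg (α := ℝ) (Fintype.card V))
        push_cast
        nlinarith
  rcases key (K ^ 2) with h | h
  · exact h
  · rw [Nat.cast_pow, sub_self, zero_mul] at h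
    have h' : ((unmatched φ (phases K L (K ^ 2) G φ)).card : ℝ) ≤ 0 := by
      by_contra hpos
      rw [not_le] at hpos
      have := mul_pos (pow_pos hK0 2) hpos
      linarith
    exact h'.trans (by positivity)

end Phases

end LocalMatching

/-! ### Choice of parameters and conclusion -/

theorem mainTheorem7 (d : ℕ) (hd : 0 < d) (ε : ℝ) (hε : 0 < ε) :
    ∃ (n l : ℕ) (N Q : Type) (_ : Finite N) (_ : Finite Q)
      (Θ : LocalMatching.BallType d l n N → Q),
      1 ≤ n ∧ n ≤ l ∧ LocalMatching.IsLarge n d N ∧ LocalMatching.IsLarge 5 d Q ∧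
      ∀ (V : Type*) [Finite V] (G : SimpleGraph V) (hG : LocalMatching.DegreeBounded G d)
        (φ : V → N) (hφ : LocalMatching.IsSeparating G n φ),
        LocalMatching.IsMatchingFunction G (LocalMatching.run Θ hG hφ) ∧
        (LocalMatching.matchingOf G (LocalMatching.run Θ hG hφ)).IsMatching ∧
        (LocalMatching.matchingNumber G : ℝ) - ε * (Nat.card V : ℝ) ≤
          ((LocalMatching.matchingOf G (LocalMatching.run Θ hG hφ)).edgeSet.ncard : ℝ) := by
  classical
  obtain ⟨K, hK⟩ := exists_nat_ge (2 / ε)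
  have hKε : 2 ≤ (K : ℝ) * ε := by rwa [div_le_iff₀ hε] at hK
  have hK1 : 1 ≤ K := by
    rcases Nat.eq_zero_or_pos K with rfl | h
    · norm_num at hKε
    · exact h
  -- Clusters need separation `3 * K`, edge labels need 6.
  let n := 3 * K + 6
  let N := Fin ((d + 1) ^ n)
  have hN : Nonempty N := ⟨⟨0, by positivity⟩⟩
  have := Fintype.ofFinite (LocalMatching.Pattern N)
  let L : List (LocalMatching.Pattern N) := Finset.univ.toList
  have hL : ∀ p, p ∈ L := fun p => Finset.mem_toList.2 (Finset.mem_univ p)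
  have hlocal : LocalMatching.Rule.IsLocal fun V G φ (x : V) =>
      LocalMatching.edgeLabel φ (LocalMatching.phases K L (K ^ 2) G φ) x :=
    LocalMatching.Rule.isLocal_label.map₂ (LocalMatching.isLocal_phases K L (K ^ 2))
      fun a b => s(a, b)
  obtain ⟨l, hl, Θ, hΘ⟩ := hlocal.exists_oracle d n
  refine ⟨n, l, N, Sym2 N, inferInstance, inferInstance, Θ, by omega, hl,
    LocalMatching.isLarge_of_le (by simp [N]), LocalMatching.isLarge_of_le ?_, ?_⟩
  · calc (d + 1) ^ 5 ≤ (d + 1) ^ n := Nat.pow_le_pow_right (by omega) (by omega)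
      _ = Nat.card N := by simp [N]
      _ ≤ Nat.card (Sym2 N) := Nat.card_le_card_of_injective Sym2.diag Sym2.diag_injective
  intro V _ G hG φ hφ
  have := Fintype.ofFinite V
  rw [hΘ V G hG φ hφ]
  have hf := LocalMatching.isPartnerLabel_phases hK1 L (K ^ 2) hφ (by omega)
  refine ⟨LocalMatching.isMatchingFunction_edgeLabel hφ (by omega) hf,
    LocalMatching.isMatching_matchingOf_edgeLabel hφ (by omega) hf, ?_⟩
  obtain ⟨M, hM, hMcard⟩ := (LocalMatching.matchingNumber_isGreatest G).1
  obtain ⟨g, hg, hgcard⟩ :=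
    LocalMatching.exists_isPartnerLabel_of_isMatching hφ (by omega) hM
  have hfcard := LocalMatching.card_eq_card_unmatched_add
    (LocalMatching.isMatching_matchingOf_edgeLabel hφ (by omega) hf)
    (LocalMatching.mem_verts_matchingOf_edgeLabel_iff hφ (by omega) hf)
  have hgap := LocalMatching.unmatched_phases_le hK1 (by omega) hL hφ hg hKε
  rw [hMcard] at hgcard
  rw [Nat.card_eq_fintype_card]
  -- Each matching edge covers two vertices, so the excess `2 * ε * |V|` of unmatched vertices costs
  -- only `ε * |V|` edges.
  have h1 := congrArg (Nat.cast (R := ℝ)) hgcard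
  have h2 := congrArg (Nat.cast (R := ℝ)) hfcard
  push_cast at h1 h2
  linarith
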